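/- Let $G$ be a Feynman graph: a finite connected multigraph with internal edges $1,\dots,n$ (loops and parallel edges allowed) and external edges (legs) $1,\dots,L$, each leg being attached to one vertex. Assume that $G$ has no bridges, i.e. deleting any single internal edge leaves $G$ connected. The kinematic parameters of $G$ are the vectors $z=(m,k)$, where $m=(m_1,\dots,m_n)\in\mathbb{R}^n$ is an arbitrary vector of (squared) internal masses and $k=(k_{ij})$ is an arbitrary real symmetric $L\times L$ matrix with zero row sums; they form a real vector space of dimension $n+\binom{L}{2}$. Let $$\mathcal{U}(x)=\sum_{T}\prod_{e\notin T}x_e,\qquad \mathcal{F}_z(x)=\sum_{\{T_1,T_2\}}\Bigl(\sum_{i\in I_{T_1}}\sum_{j\in I_{T_2}}k_{ij}\Bigr)\prod_{e\notin T_1\sqcup T_2}x_e+\Bigl(\sum_{e=1}^n m_ex_e\Bigr)\,\mathcal{U}(x)$$ be the Symanzik polynomials of $G$ in the variables $x_1,\dots,x_n$, where $T$ runs over the spanning trees and $\{T_1,T_2\}$ over the spanning 2-forests of $G$ (acyclic spanning subgraphs with exactly two connected components $T_1,T_2$), and $I_{T_1},I_{T_2}$ are the sets of legs attached to $T_1,T_2$.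 Let $\mathcal{C}_G$ be the copositive cone, i.e. the set of all kinematic parameters $z$ with $\mathcal{F}_z(x)\ge 0$ for all $x\in\mathbb{R}^n_{\ge 0}$. Then a kinematic parameter vector $z$ lies in the interior of $\mathcal{C}_G$, taken in the space of kinematic parameters, if and only if $m_1,\dots,m_n>0$ and there exists $N\in\mathbb{N}$ such that $(x_1+\dots+x_n)^N\,\mathcal{F}_z$ has only positive coefficients, i.e. all of its nonzero coefficients are positive. -/

import Mathlib

/-- The combinatorial data of a Feynman graph: a finite multigraph with vertex set `V` and internal
edges `E` (loops and parallel edges are allowed), and external edges (legs) `L`, each attached to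
one vertex. The valency-one end points of the legs are not listed in `V`. -/
structure FeynmanGraph (V E L : Type*) where
  /-- The two end points of an internal edge. -/
  ends : E → Sym2 V
  /-- The vertex to which an external edge is attached. -/
  leg : L → V

namespace FeynmanGraph

variable {V E L : Type*}

/-- The adjacency structure of the spanning subgraph whose internal edges are those in `S`; it has
the same connected components as this subgraph. -/
def sub (G : FeynmanGraph V E L) (S : Set E) : SimpleGraph V :=
  SimpleGraph.fromEdgeSet (G.ends '' S)

/-- `G` is connected (in particular it has a vertex). -/
def IsConnected (G : FeynmanGraph V E L) : Prop :=
  (G.sub Set.univ).Connected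

/-- `G` has no bridges: no internal edge disconnects `G` when it is removed. -/
def IsBridgeless (G : FeynmanGraph V E L) : Prop :=
  ∀ e : E, (G.sub {e}ᶜ).Connected

/-- The edge set `S` contains no cycle: no cycle of length one (a loop), none of length two (a pair
of parallel edges) and none of length at least three. -/
def IsForest (G : FeynmanGraph V E L) (S : Set E) : Prop :=
  (∀ e ∈ S, ¬ (G.ends e).IsDiag) ∧ Set.InjOn G.ends S ∧ (G.sub S).IsAcyclic

/-- Edge sets of spanning trees. -/
def IsSpanningTree (G : FeynmanGraph V E L) (S : Set E) : Prop :=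
  G.IsForest S ∧ (G.sub S).Connected

/-- Edge sets of spanning 2-forests: no cycle, and exactly two connected components. -/
def IsTwoForest (G : FeynmanGraph V E L) (S : Set E) : Prop :=
  G.IsForest S ∧ Nat.card (G.sub S).ConnectedComponent = 2

/-- The component of the spanning subgraph `S` to which the leg `i` is attached. -/
def legComponent (G : FeynmanGraph V E L) (S : Set E) (i : L) : (G.sub S).ConnectedComponent :=
  (G.sub S).connectedComponentMk (G.leg i)

/-- The kinematic space: vectors `(m, k)` of internal (squared) masses `m`, which are arbitrary real
numbers, and a symmetric matrix `k` with zero row sums, indexed by the legs. -/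
def KinematicSpace (E L : Type*) [Fintype L] : Submodule ℝ ((E → ℝ) × Matrix L L ℝ) where
  carrier := {z | z.2.IsSymm ∧ ∀ i, ∑ j, z.2 i j = 0}
  add_mem' := by
    rintro a b ⟨ha, ha'⟩ ⟨hb, hb'⟩
    refine ⟨ha.add hb, fun i => ?_⟩
    simp [Finset.sum_add_distrib, ha', hb']
  zero_mem' := by
    refine ⟨Matrix.isSymm_zero, fun i => ?_⟩
    simp
  smul_mem' := by
    rintro c a ⟨ha, ha'⟩
    refine ⟨ha.smul c, fun i => ?_⟩
    simp [← Finset.mul_sum, ha']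

section Symanzik

variable [Fintype L]

open Classical in
/-- The sum of `k i j` over the pairs of legs `i`, `j` with `i` attached to one component of the
2-forest `S` and `j` to the other. Each unordered pair of legs in different components occurs twice
in the double sum, whence the factor `1 / 2`; see `crossing_eq`. -/
noncomputable def crossing (G : FeynmanGraph V E L) (S : Set E) (k : Matrix L L ℝ) : ℝ :=
  (1 / 2) * ∑ i : L, ∑ j : L with G.legComponent S i ≠ G.legComponent S j, k i j

open Classical in
/-- If `T₁`, `T₂` are the two components of the 2-forest `S`, then `crossing` is the sum of `k i j`
over the legs `i` at `T₁` and `j` at `T₂`. -/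
theorem crossing_eq (G : FeynmanGraph V E L) {S : Set E} (hS : G.IsTwoForest S)
    {k : Matrix L L ℝ} (hk : k.IsSymm) {T₁ T₂ : (G.sub S).ConnectedComponent} (hT : T₁ ≠ T₂) :
    G.crossing S k =
      ∑ i : L with G.legComponent S i = T₁, ∑ j : L with G.legComponent S j = T₂, k i j := by
  have hall : ∀ C : (G.sub S).ConnectedComponent, C = T₁ ∨ C = T₂ := by
    intro C
    by_contra! h
    have : Finite (G.sub S).ConnectedComponent :=
      Nat.finite_of_card_ne_zero (by rw [hS.2]; norm_num)
    have := Fintype.ofFinite (G.sub S).ConnectedComponent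
    have h3 : ({C, T₁, T₂} : Finset _).card = 3 := Finset.card_eq_three.2
      ⟨C, T₁, T₂, h.1, h.2, hT, rfl⟩
    have := Finset.card_le_univ ({C, T₁, T₂} : Finset (G.sub S).ConnectedComponent)
    rw [h3, ← Nat.card_eq_fintype_card, hS.2] at this
    omega
  have key : ∀ i j : L, (if G.legComponent S i ≠ G.legComponent S j then k i j else 0) =
      (if G.legComponent S i = T₁ then (if G.legComponent S j = T₂ then k i j else 0) else 0) +
      (if G.legComponent S j = T₁ then (if G.legComponent S i = T₂ then k j i else 0) else 0) := by
    intro i j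
    have hs : k j i = k i j := hk.apply i j
    rcases hall (G.legComponent S i) with h1 | h1 <;>
      rcases hall (G.legComponent S j) with h2 | h2 <;>
      simp [h1, h2, hT, hT.symm, hs]
  unfold crossing
  simp only [Finset.sum_filter, key, Finset.sum_add_distrib, Finset.sum_ite_irrel,
    Finset.sum_const_zero]
  rw [Finset.sum_comm (f := fun i j => if G.legComponent S j = T₁ then
    (if G.legComponent S i = T₂ then k j i else 0) else 0)]
  simp only [Finset.sum_ite_irrel, Finset.sum_const_zero]
  ring

variable [Fintype E]

open Classical in
/-- The first Symanzik polynomial. -/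
noncomputable def firstSymanzik (G : FeynmanGraph V E L) : MvPolynomial E ℝ :=
  ∑ T : Finset E with G.IsSpanningTree (T : Set E),
    ∏ e : E with e ∉ T, MvPolynomial.X e

open Classical in
/-- The second Symanzik polynomial `F_z`, for `z = (m, k)`. -/
noncomputable def secondSymanzik (G : FeynmanGraph V E L) (z : KinematicSpace E L) :
    MvPolynomial E ℝ :=
  (∑ S : Finset E with G.IsTwoForest (S : Set E),
      MvPolynomial.C (G.crossing (S : Set E) z.1.2) * ∏ e : E with e ∉ S, MvPolynomial.X e) +
    (∑ e : E, MvPolynomial.C (z.1.1 e) * MvPolynomial.X e) * G.firstSymanzik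

/-- The copositive cone: all kinematic vectors `z` such that `F_z` is nonnegative on the
nonnegative orthant. -/
def copositiveCone (G : FeynmanGraph V E L) : Set (KinematicSpace E L) :=
  {z | ∀ x : E → ℝ, (∀ e, 0 ≤ x e) → 0 ≤ MvPolynomial.eval x (G.secondSymanzik z)}

end Symanzik

end FeynmanGraph

/-- All coefficients that occur in the polynomial `f` are positive. -/
def HasOnlyPositiveCoeffs {σ : Type*} (f : MvPolynomial σ ℝ) : Prop :=
  ∀ d ∈ f.support, 0 < f.coeff d

/-!
Write `σ = ∑ e, x e`. A kinematic vector `z` is interior to the copositive cone iff `F_z ≥ ε σ U` on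
the orthant for some `ε > 0`: subtracting `ε` from every mass changes `F_z` by `-ε σ U`, and
`|F_w| ≤ D(w) σ U` with `D` continuous and `D(0) = 0`, since every 2-forest is a spanning tree minus
an edge.

Given such an `ε`, the proof of Pólya's theorem applies. Up to a positive factor, the coefficient of
`x ^ c` in `σ ^ N F_z` is `F_z` with the powers `c e ^ k` replaced by falling factorials, evaluated
at `c`. The exponents in `F_z` are at most two, and those with an entry two come from the terms
`x e * U`, so the error is at most a constant times `U(c)`, which `ε σ(c) U(c)` absorbs for `N`
large. The masses are positive because on the face where the coordinates of a spanning tree `T`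
vanish, `F_z` is the product of `∑ e, m e * x e` and the monomial of `T`, and each edge avoids some
spanning tree.

Conversely, a polynomial with positive coefficients is monotone on the orthant. Comparing
`σ ^ N F_z` at `x` with its value on the face of `T` gives
`m e * x e ^ (N + 1) * ∏_{f ∉ T} x f ≤ σ ^ N F_z` for `e ∉ T`. If `e ∈ T`, then, as `e` is not a
bridge, it can be exchanged for another edge at the cost of one more factor `σ` on the right and one
more `x e` on the left. Summing over `e` and `T` gives `σ U ≤ K F_z`.
-/

namespace FeynmanGraph

section Forests

variable {V E L : Type*} {G : FeynmanGraph V E L} {S T A : Set E}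

theorem sub_adj {a b : V} : (G.sub S).Adj a b ↔ (∃ f ∈ S, G.ends f = s(a, b)) ∧ a ≠ b := by
  simp [sub]

theorem sub_mono (h : S ⊆ T) : G.sub S ≤ G.sub T :=
  SimpleGraph.fromEdgeSet_mono (Set.image_mono h)

theorem sub_insert {f : E} {u v : V} (hf : G.ends f = s(u, v)) :
    G.sub (insert f S) = G.sub S ⊔ SimpleGraph.edge u v := by
  rw [sub, Set.image_insert_eq, hf, Set.insert_eq, Set.union_comm, SimpleGraph.fromEdgeSet_union]
  rfl

theorem reachable_of_ends_eq {f : E} (hfS : f ∈ S) {u v : V} (hf : G.ends f = s(u, v)) :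
    (G.sub S).Reachable u v := by
  rcases eq_or_ne u v with rfl | huv
  · exact SimpleGraph.Reachable.refl u
  · exact (sub_adj.2 ⟨⟨f, hfS, hf⟩, huv⟩).reachable

theorem connected_of_forall_ends_reachable (hA : (G.sub A).Connected)
    (h : ∀ f ∈ A, ∀ u v, G.ends f = s(u, v) → (G.sub S).Reachable u v) :
    (G.sub S).Connected := by
  refine (SimpleGraph.connected_iff _).2 ⟨fun a b => ?_, hA.nonempty⟩
  obtain ⟨walk⟩ := hA.preconnected a b
  induction walk with
  | nil => exact SimpleGraph.Reachable.refl _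
  | cons hadj _ ih =>
    obtain ⟨⟨f, hfA, hf⟩, -⟩ := sub_adj.1 hadj
    exact (h f hfA _ _ hf).trans ih

theorem isForest_empty : G.IsForest ∅ := by
  simp [IsForest, sub]

theorem IsForest.anti (hT : G.IsForest T) (h : S ⊆ T) : G.IsForest S :=
  ⟨fun e he => hT.1 e (h he), hT.2.1.mono h, hT.2.2.anti (sub_mono h)⟩

theorem IsForest.insert (hS : G.IsForest S) {f : E} {u v : V} (hf : G.ends f = s(u, v))
    (huv : ¬ (G.sub S).Reachable u v) : G.IsForest (insert f S) := by
  have hne : u ≠ v := by rintro rfl; exact huv (SimpleGraph.Reachable.refl _)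
  have hnotMem : G.ends f ∉ G.ends '' S := fun ⟨g, hgS, hg⟩ =>
    huv (reachable_of_ends_eq hgS (hg.trans hf))
  refine ⟨?_, ?_, ?_⟩
  · rintro e (rfl | he)
    · simpa [hf] using hne
    · exact hS.1 e he
  · exact (Set.injOn_insert fun hfS => hnotMem ⟨f, hfS, rfl⟩).2 ⟨hS.2.1, hnotMem⟩
  · rw [sub_insert hf]
    exact hS.2.2.sup_edge_of_not_reachable huv

theorem IsForest.exists_isSpanningTree_between [Finite E] (hS : G.IsForest S) (hSA : S ⊆ A)
    (hA : (G.sub A).Connected) : ∃ T, S ⊆ T ∧ T ⊆ A ∧ G.IsSpanningTree T := by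
  obtain ⟨T, hST, hT⟩ :=
    Finite.exists_le_maximal (p := fun T => T ⊆ A ∧ G.IsForest T) ⟨hSA, hS⟩
  obtain ⟨hTA, hforest⟩ := hT.prop
  refine ⟨T, hST, hTA, hforest, connected_of_forall_ends_reachable hA fun f hfA u v hf => ?_⟩
  by_contra huv
  have hfT : f ∈ T := hT.le_of_ge ⟨Set.insert_subset hfA hTA, hforest.insert hf huv⟩
    (Set.subset_insert f T) (Set.mem_insert f T)
  exact huv (reachable_of_ends_eq hfT hf)

theorem IsBridgeless.exists_isSpanningTree_notMem [Finite E] (hbridge : G.IsBridgeless) (e : E) :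
    ∃ T, G.IsSpanningTree T ∧ e ∉ T := by
  obtain ⟨T, -, hTe, hT⟩ :=
    isForest_empty.exists_isSpanningTree_between (Set.empty_subset _) (hbridge e)
  exact ⟨T, hT, fun he => hTe he rfl⟩

theorem IsForest.edgeSet_sub (hS : G.IsForest S) : (G.sub S).edgeSet = G.ends '' S := by
  rw [sub, SimpleGraph.edgeSet_fromEdgeSet]
  refine sdiff_eq_left.2 (Set.disjoint_left.2 ?_)
  rintro _ ⟨e, he, rfl⟩ hdiag
  exact hS.1 e he (by simpa using hdiag)

theorem IsSpanningTree.ncard_add_one [Finite V] (hT : G.IsSpanningTree T) :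
    T.ncard + 1 = Nat.card V := by
  have htree : (G.sub T).IsTree := ⟨hT.2, hT.1.2.2⟩
  rw [← (SimpleGraph.isTree_iff_connected_and_card.1 htree).2, hT.1.edgeSet_sub,
    Nat.card_coe_set_eq, hT.1.2.1.ncard_image]

theorem IsSpanningTree.eq_of_subset [Finite V] [Finite E] (hS : G.IsSpanningTree S)
    (hT : G.IsSpanningTree T) (h : S ⊆ T) : S = T := by
  refine Set.eq_of_subset_of_ncard_le h ?_
  have := hS.ncard_add_one
  have := hT.ncard_add_one
  omega

theorem IsSpanningTree.exists_exchange [Finite V] [Finite E] (hT : G.IsSpanningTree T) {e : E}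
    (he : e ∈ T) (hbridge : (G.sub {e}ᶜ).Connected) :
    ∃ f ∉ T \ {e}, G.IsSpanningTree (insert f (T \ {e})) ∧ e ∉ insert f (T \ {e}) := by
  obtain ⟨T', hTT', hT'e, hT'⟩ := (hT.1.anti Set.sdiff_subset).exists_isSpanningTree_between
    (A := {e}ᶜ) (fun _ h => h.2) hbridge
  have hcard : (T \ {e}).ncard + 1 = T'.ncard := by
    rw [Set.ncard_sdiff_singleton_add_one he]
    have := hT.ncard_add_one
    have := hT'.ncard_add_one
    omega
  obtain ⟨f, hf, rfl⟩ := (Set.exists_eq_insert_iff_ncard (Set.toFinite _)).2 ⟨hTT', hcard⟩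
  exact ⟨f, hf, hT', fun h => hT'e h rfl⟩

theorem IsTwoForest.not_connected (hS : G.IsTwoForest S) : ¬ (G.sub S).Connected := fun h => by
  have := h.preconnected.subsingleton_connectedComponent
  exact absurd hS.2 (Finite.card_le_one_iff_subsingleton.2 this |>.trans_lt one_lt_two).ne

theorem IsTwoForest.exists_isSpanningTree_insert (hS : G.IsTwoForest S) (hconn : G.IsConnected) :
    ∃ f ∉ S, G.IsSpanningTree (insert f S) := by
  obtain ⟨f, u, v, hf, huv⟩ : ∃ f u v, G.ends f = s(u, v) ∧ ¬ (G.sub S).Reachable u v := by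
    by_contra! h
    exact hS.not_connected (connected_of_forall_ends_reachable hconn fun f _ => h f)
  have hmk : ∀ {a b}, (G.sub S).connectedComponentMk a = (G.sub S).connectedComponentMk b ↔
      (G.sub S).Reachable a b := SimpleGraph.ConnectedComponent.eq
  have hcover (w : V) : (G.sub S).Reachable w u ∨ (G.sub S).Reachable w v := by
    refine or_iff_not_imp_left.2 fun hwu => hmk.1 ?_
    exact ((Nat.card_eq_two_iff' _).1 hS.2).unique (mt hmk.1 hwu) (mt hmk.1 fun h => huv h.symm)
  have hmono := sub_mono (G := G) (Set.subset_insert f S)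
  have hvu := (reachable_of_ends_eq (Set.mem_insert f S) hf).symm
  have hreach (w : V) : (G.sub (insert f S)).Reachable w u :=
    (hcover w).elim (fun h => h.mono hmono) fun h => (h.mono hmono).trans hvu
  exact ⟨f, fun hfS => huv (reachable_of_ends_eq hfS hf), hS.1.insert hf huv,
    (SimpleGraph.connected_iff _).2 ⟨fun a b => (hreach a).trans (hreach b).symm, ⟨u⟩⟩⟩

end Forests

end FeynmanGraph

section PositiveCoefficients

open MvPolynomial

variable {σ : Type*} {p q : MvPolynomial σ ℝ}

theorem hasOnlyPositiveCoeffs_iff_coeff_nonneg :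
    HasOnlyPositiveCoeffs p ↔ ∀ d, 0 ≤ p.coeff d := by
  refine ⟨fun h d => ?_, fun h d hd => (h d).lt_of_ne' (mem_support_iff.1 hd)⟩
  by_cases hd : d ∈ p.support
  · exact (h d hd).le
  · rw [notMem_support_iff.1 hd]

theorem HasOnlyPositiveCoeffs.eval_mono (hp : HasOnlyPositiveCoeffs p) {x y : σ → ℝ}
    (hx : ∀ i, 0 ≤ x i) (hxy : ∀ i, x i ≤ y i) : eval x p ≤ eval y p := by
  rw [eval_eq, eval_eq]
  refine Finset.sum_le_sum fun d hd => mul_le_mul_of_nonneg_left ?_ (hp d hd).le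
  exact Finset.prod_le_prod (fun i _ => pow_nonneg (hx i) _)
    fun i _ => pow_le_pow_left₀ (hx i) (hxy i) _

theorem HasOnlyPositiveCoeffs.eval_nonneg (hp : HasOnlyPositiveCoeffs p) {x : σ → ℝ}
    (hx : ∀ i, 0 ≤ x i) : 0 ≤ eval x p := by
  rw [eval_eq]
  exact Finset.sum_nonneg fun d hd =>
    mul_nonneg (hp d hd).le (Finset.prod_nonneg fun i _ => pow_nonneg (hx i) _)

theorem HasOnlyPositiveCoeffs.coeff_mul_prod_pow_le_eval [Fintype σ]
    (hp : HasOnlyPositiveCoeffs p) {d : σ →₀ ℕ} (hd : d ∈ p.support) {x : σ → ℝ}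
    (hx : ∀ i, 0 ≤ x i) : p.coeff d * ∏ i, x i ^ d i ≤ eval x p := by
  rw [eval_eq']
  exact Finset.single_le_sum (f := fun d => p.coeff d * ∏ i, x i ^ d i)
    (fun d hd => mul_nonneg (hp d hd).le (Finset.prod_nonneg fun i _ => pow_nonneg (hx i) _)) hd

end PositiveCoefficients

section Polya

open MvPolynomial Nat

theorem pow_le_descFactorial_add_choose_two_mul_pow (n k : ℕ) :
    n ^ k ≤ n.descFactorial k + k.choose 2 * n ^ (k - 1) := by
  induction k with
  | zero => simp
  | succ k ih =>
    have hshift : n * (k.choose 2 * n ^ (k - 1)) = k.choose 2 * n ^ k := by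
      rcases k with _ | k
      · simp
      · rw [Nat.add_sub_cancel, pow_succ]; ring
    have hdesc : n * n.descFactorial k ≤ n.descFactorial (k + 1) + k * n ^ k :=
      calc n * n.descFactorial k ≤ ((n - k) + k) * n.descFactorial k := by gcongr; omega
        _ = n.descFactorial (k + 1) + k * n.descFactorial k := by
          rw [add_mul, Nat.descFactorial_succ]
        _ ≤ n.descFactorial (k + 1) + k * n ^ k := by
          gcongr; exact Nat.descFactorial_le_pow n k
    calc n ^ (k + 1) = n * n ^ k := pow_succ' n k
      _ ≤ n * (n.descFactorial k + k.choose 2 * n ^ (k - 1)) := by gcongr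
      _ = n * n.descFactorial k + k.choose 2 * n ^ k := by rw [mul_add, hshift]
      _ ≤ n.descFactorial (k + 1) + k * n ^ k + k.choose 2 * n ^ k := by gcongr
      _ = n.descFactorial (k + 1) + (k + 1).choose 2 * n ^ (k + 1 - 1) := by
        rw [Nat.choose_succ_succ' k 1, Nat.choose_one_right, Nat.add_sub_cancel]; ring

theorem prod_le_prod_add_sum_mul_prod_erase {ι R : Type*} [DecidableEq ι] [CommSemiring R]
    [PartialOrder R] [IsOrderedRing R] {s : Finset ι} {a b r : ι → R} (hb : ∀ i ∈ s, 0 ≤ b i)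
    (hr : ∀ i ∈ s, 0 ≤ r i) (hba : ∀ i ∈ s, b i ≤ a i) (har : ∀ i ∈ s, a i ≤ b i + r i) :
    ∏ i ∈ s, a i ≤ ∏ i ∈ s, b i + ∑ i ∈ s, r i * ∏ j ∈ s.erase i, a j := by
  induction s using Finset.induction_on with
  | empty => simp
  | insert k s hk ih =>
    simp only [Finset.forall_mem_insert] at hb hr hba har
    have ha0 : ∀ i ∈ s, 0 ≤ a i := fun i hi => (hb.2 i hi).trans (hba.2 i hi)
    have herase : ∀ i ∈ s, r i * ∏ j ∈ (insert k s).erase i, a j =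
        a k * (r i * ∏ j ∈ s.erase i, a j) := fun i hi => by
      rw [Finset.erase_insert_of_ne (ne_of_mem_of_not_mem hi hk).symm,
        Finset.prod_insert (fun h => hk (Finset.mem_of_mem_erase h)), mul_left_comm]
    have hsum0 : 0 ≤ ∑ i ∈ s, r i * ∏ j ∈ s.erase i, a j := Finset.sum_nonneg fun i hi =>
      mul_nonneg (hr.2 i hi) (Finset.prod_nonneg fun j hj => ha0 j (Finset.mem_of_mem_erase hj))
    rw [Finset.prod_insert hk, Finset.prod_insert hk, Finset.sum_insert hk,
      Finset.erase_insert hk, Finset.sum_congr rfl herase, ← Finset.mul_sum]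
    calc a k * ∏ i ∈ s, a i ≤ (b k + r k) * ∏ i ∈ s, a i :=
          mul_le_mul_of_nonneg_right har.1 (Finset.prod_nonneg ha0)
      _ = b k * ∏ i ∈ s, a i + r k * ∏ i ∈ s, a i := add_mul _ _ _
      _ ≤ b k * (∏ i ∈ s, b i + ∑ i ∈ s, r i * ∏ j ∈ s.erase i, a j) + r k * ∏ i ∈ s, a i := by
          gcongr
          · exact hb.1
          · exact ih hb.2 hr.2 hba.2 har.2
      _ ≤ b k * ∏ i ∈ s, b i + a k * (∑ i ∈ s, r i * ∏ j ∈ s.erase i, a j) +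
            r k * ∏ i ∈ s, a i := by
          rw [mul_add]
          gcongr
          exact hba.1
      _ = _ := by ring

variable {σ : Type*} [Fintype σ]

theorem prod_pow_le_prod_descFactorial_add (c b : σ →₀ ℕ) :
    ∏ i, c i ^ b i ≤ ∏ i, (c i).descFactorial (b i) +
      ∑ i, (b i).choose 2 * ∏ j, c j ^ (b - Finsupp.single i 1 : σ →₀ ℕ) j := by
  classical
  have hprod (i : σ) : ∏ j, c j ^ (b - Finsupp.single i 1 : σ →₀ ℕ) j =
      c i ^ (b i - 1) * ∏ j ∈ Finset.univ.erase i, c j ^ b j := by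
    rw [← Finset.mul_prod_erase _ _ (Finset.mem_univ i)]
    congr 1
    · simp
    · refine Finset.prod_congr rfl fun j hj => ?_
      simp [(Finset.ne_of_mem_erase hj).symm]
  simp only [hprod, ← mul_assoc]
  exact prod_le_prod_add_sum_mul_prod_erase (fun _ _ => Nat.zero_le _) (fun _ _ => Nat.zero_le _)
    (fun i _ => Nat.descFactorial_le_pow _ _)
    (fun i _ => pow_le_descFactorial_add_choose_two_mul_pow _ _)

theorem prod_factorial_mul_coeff_sum_X_pow {R : Type*} [CommSemiring R] {N : ℕ} {d : σ →₀ ℕ}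
    (h : d.degree = N) : (∏ i, (d i)! : ℕ) * coeff d ((∑ i, X i : MvPolynomial σ R) ^ N) = N ! := by
  have hsum : d.sum (fun _ m => m) = N := h
  rw [coeff_sum_X_pow_of_fintype, if_pos hsum,
    ← Finsupp.multinomial_of_support_subset (Finset.subset_univ _), ← Nat.cast_mul,
    Nat.multinomial_spec, ← Finsupp.degree_eq_sum, h]

theorem prod_factorial_mul_coeff_sum_X_pow_mul_monomial {R : Type*} [CommSemiring R] {N : ℕ}
    {c b : σ →₀ ℕ} (h : c.degree = N + b.degree) (r : R) :
    (∏ i, (c i)! : ℕ) * coeff c ((∑ i, X i : MvPolynomial σ R) ^ N * monomial b r) =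
      N ! * (r * (∏ i, (c i).descFactorial (b i) : ℕ)) := by
  rw [coeff_mul_monomial']
  split_ifs with hbc
  · have hdeg : (c - b).degree = N := by
      have : (c - b).degree + b.degree = c.degree := by rw [← map_add, tsub_add_cancel_of_le hbc]
      omega
    have hfac : ∏ i, (c i)! = (∏ i, ((c - b) i)!) * ∏ i, (c i).descFactorial (b i) := by
      rw [← Finset.prod_mul_distrib]
      refine Finset.prod_congr rfl fun i _ => ?_
      rw [Finsupp.tsub_apply, Nat.factorial_mul_descFactorial (hbc i)]
    rw [hfac, ← prod_factorial_mul_coeff_sum_X_pow (R := R) hdeg]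
    push_cast
    ring
  · obtain ⟨i, hi⟩ : ∃ i, c i < b i := by
      by_contra! hle
      exact hbc hle
    have hdesc : ∏ i, (c i).descFactorial (b i) = 0 :=
      Finset.prod_eq_zero (Finset.mem_univ i) (Nat.descFactorial_of_lt hi)
    rw [hdesc, Nat.cast_zero, mul_zero, mul_zero, mul_zero]

theorem prod_factorial_mul_coeff_sum_X_pow_mul {R : Type*} [CommSemiring R] {p : MvPolynomial σ R}
    {n N : ℕ} (hp : p.IsHomogeneous n) {c : σ →₀ ℕ} (hc : c.degree = N + n) :
    (∏ i, (c i)! : ℕ) * coeff c ((∑ i, X i) ^ N * p) =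
      N ! * ∑ b ∈ p.support, coeff b p * (∏ i, (c i).descFactorial (b i) : ℕ) := by
  conv_lhs => rw [p.as_sum, Finset.mul_sum, coeff_sum, Finset.mul_sum]
  rw [Finset.mul_sum]
  refine Finset.sum_congr rfl fun b hb => ?_
  have hdeg : b.degree = n := not_imp_comm.1 hp.coeff_eq_zero (mem_support_iff.1 hb)
  exact prod_factorial_mul_coeff_sum_X_pow_mul_monomial (hdeg ▸ hc) _

variable {p q : MvPolynomial σ ℝ}

theorem exists_eval_natCast_le_sum_descFactorial_add (hq : HasOnlyPositiveCoeffs q)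
    (hsupp : ∀ b ∈ p.support, ∀ i, 2 ≤ b i → b - Finsupp.single i 1 ∈ q.support) :
    ∃ M : ℝ, ∀ c : σ →₀ ℕ, eval (fun i => (c i : ℝ)) p ≤
      ∑ b ∈ p.support, coeff b p * (∏ i, (c i).descFactorial (b i) : ℕ) +
        M * eval (fun i => (c i : ℝ)) q := by
  refine ⟨∑ b ∈ p.support, |coeff b p| *
    ∑ i, (b i).choose 2 / coeff (b - Finsupp.single i 1) q, fun c => ?_⟩
  rw [eval_eq', Finset.sum_mul, ← Finset.sum_add_distrib]
  refine Finset.sum_le_sum fun b hb => ?_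
  set Q := eval (fun i => (c i : ℝ)) q
  have hterm (i : σ) : (b i).choose 2 * ∏ j, (c j : ℝ) ^ (b - Finsupp.single i 1 : σ →₀ ℕ) j ≤
      (b i).choose 2 / coeff (b - Finsupp.single i 1) q * Q := by
    rcases lt_or_ge (b i) 2 with hbi | hbi
    · simp [Nat.choose_eq_zero_of_lt hbi]
    · have hmem := hsupp b hb i hbi
      rw [div_mul_eq_mul_div, mul_div_assoc]
      gcongr
      rw [le_div_iff₀' (hq _ hmem)]
      exact hq.coeff_mul_prod_pow_le_eval hmem fun i => Nat.cast_nonneg _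
  have hdesc : (∏ i, (c i).descFactorial (b i) : ℕ) ≤ ∏ i, (c i : ℝ) ^ b i := by
    exact_mod_cast Finset.prod_le_prod' fun i _ => Nat.descFactorial_le_pow (c i) (b i)
  have hpow : ∏ i, (c i : ℝ) ^ b i - (∏ i, (c i).descFactorial (b i) : ℕ) ≤
      (∑ i, (b i).choose 2 / coeff (b - Finsupp.single i 1) q) * Q := by
    rw [sub_le_iff_le_add', Finset.sum_mul]
    refine le_trans ?_ (add_le_add_right (Finset.sum_le_sum fun i _ => hterm i) _)
    exact_mod_cast prod_pow_le_prod_descFactorial_add c b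
  rw [← sub_le_iff_le_add', ← mul_sub, mul_assoc]
  exact mul_le_mul (le_abs_self _) hpow (sub_nonneg.2 hdesc) (abs_nonneg _)

/- With `q = (∑ i, X i) ^ (n - 1)` this is Pólya's theorem on forms that are positive on the
simplex; a sparser `q` allows `p` to vanish on some faces. -/
theorem exists_hasOnlyPositiveCoeffs_sum_X_pow_mul {n : ℕ} (hp : p.IsHomogeneous n)
    (hq : HasOnlyPositiveCoeffs q)
    (hsupp : ∀ b ∈ p.support, ∀ i, 2 ≤ b i → b - Finsupp.single i 1 ∈ q.support)
    {ε : ℝ} (hε : 0 < ε)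
    (hle : ∀ x : σ → ℝ, (∀ i, 0 ≤ x i) → ε * ((∑ i, x i) * eval x q) ≤ eval x p) :
    ∃ N : ℕ, HasOnlyPositiveCoeffs ((∑ i, X i) ^ N * p) := by
  obtain ⟨M, hM⟩ := exists_eval_natCast_le_sum_descFactorial_add hq hsupp
  obtain ⟨N, hN⟩ := exists_nat_ge (M / ε)
  refine ⟨N, hasOnlyPositiveCoeffs_iff_coeff_nonneg.2 fun c => ?_⟩
  by_cases hc : c.degree = N + n
  · have hc0 (i : σ) : (0 : ℝ) ≤ c i := Nat.cast_nonneg _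
    have hNc : (N : ℝ) ≤ ∑ i, (c i : ℝ) := by
      rw [Finsupp.degree_eq_sum] at hc
      exact_mod_cast (Nat.le_add_right N n).trans_eq hc.symm
    have hMε : M ≤ ε * ∑ i, (c i : ℝ) := (div_le_iff₀' hε).1 (hN.trans hNc)
    have hfac : (0 : ℝ) < (∏ i, (c i)! : ℕ) :=
      Nat.cast_pos.2 (Finset.prod_pos fun i _ => Nat.factorial_pos _)
    refine nonneg_of_mul_nonneg_right ?_ hfac
    rw [prod_factorial_mul_coeff_sum_X_pow_mul hp hc]
    refine mul_nonneg (Nat.cast_nonneg _) ?_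
    have hMq := mul_le_mul_of_nonneg_right hMε (hq.eval_nonneg hc0)
    linarith [hM c, hle _ hc0]
  · have hhom : ((∑ i, X i) ^ N * p).IsHomogeneous (1 * N + n) :=
      ((IsHomogeneous.sum _ _ _ fun i _ => isHomogeneous_X ℝ i).pow N).mul hp
    rw [one_mul] at hhom
    rw [hhom.coeff_eq_zero hc]

end Polya

namespace FeynmanGraph

section Crossing

variable {V E L : Type*} [Fintype L]

theorem crossing_sub (G : FeynmanGraph V E L) (S : Set E) (k l : Matrix L L ℝ) :
    G.crossing S (k - l) = G.crossing S k - G.crossing S l := by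
  simp [crossing, Finset.sum_sub_distrib, mul_sub]

theorem crossing_zero (G : FeynmanGraph V E L) (S : Set E) : G.crossing S 0 = 0 := by
  simp [crossing]

theorem continuous_crossing (G : FeynmanGraph V E L) (S : Set E) : Continuous (G.crossing S) := by
  unfold crossing
  fun_prop

end Crossing

section Complement

open MvPolynomial

variable {E : Type*} [Finite E] {S : Set E} {x : E → ℝ}

/-- The product of the coordinates of `x` outside `S`: the value at `x` of the monomial which the
Symanzik polynomials attach to a spanning tree or 2-forest `S`. -/
noncomputable def complProd (S : Set E) (x : E → ℝ) : ℝ :=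
  ∏ e ∈ Sᶜ.toFinite.toFinset, x e

/-- The indicator function of the complement of `S`: the exponent of the monomial which the
Symanzik polynomials attach to a spanning tree or 2-forest `S`. -/
noncomputable def complExponent (S : Set E) : E →₀ ℕ :=
  ∑ e ∈ Sᶜ.toFinite.toFinset, Finsupp.single e 1

theorem complProd_nonneg (S : Set E) (hx : ∀ e, 0 ≤ x e) : 0 ≤ complProd S x :=
  Finset.prod_nonneg fun e _ => hx e

theorem complProd_pos (hx : ∀ e ∉ S, 0 < x e) : 0 < complProd S x :=
  Finset.prod_pos fun e he => hx e (by simpa using he)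

theorem complProd_congr {y : E → ℝ} (h : ∀ e ∉ S, x e = y e) : complProd S x = complProd S y :=
  Finset.prod_congr rfl fun e he => h e (by simpa using he)

theorem complProd_eq_zero {e : E} (he : e ∉ S) (hxe : x e = 0) : complProd S x = 0 :=
  Finset.prod_eq_zero (by simpa using he) hxe

theorem complProd_eq_mul_insert {f : E} (hf : f ∉ S) :
    complProd S x = x f * complProd (insert f S) x := by
  classical
  have hinsert : Sᶜ.toFinite.toFinset = insert f (insert f S)ᶜ.toFinite.toFinset := by
    ext e; by_cases e = f <;> simp_all
  rw [complProd, complProd, hinsert, Finset.prod_insert (by simp)]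

theorem complExponent_apply_le_one (S : Set E) (e : E) : complExponent S e ≤ 1 := by
  classical
  simp only [complExponent, Finsupp.finsetSum_apply, Finsupp.single_apply, Finset.sum_ite_eq']
  split_ifs <;> simp

theorem degree_complExponent (S : Set E) : (complExponent S).degree = Sᶜ.ncard := by
  simp [complExponent, Set.ncard_eq_toFinset_card Sᶜ]

theorem monomial_complExponent (S : Set E) (r : ℝ) :
    monomial (complExponent S) r = C r * ∏ e ∈ Sᶜ.toFinite.toFinset, X e := by
  rw [← mul_one r, ← C_mul_monomial, complExponent, monomial_sum_one, mul_one]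
  rfl

theorem eval_monomial_complExponent (S : Set E) (r : ℝ) :
    eval x (monomial (complExponent S) r) = r * complProd S x := by
  simp [monomial_complExponent, complProd]

end Complement

section Symanzik

open MvPolynomial

variable {V E L : Type*} [Fintype E] {G : FeynmanGraph V E L} {S T : Set E} {x : E → ℝ}

open scoped Classical in
/-- The edge sets of the spanning trees of `G`, which index the terms of `G.firstSymanzik`. -/
noncomputable def spanningTrees (G : FeynmanGraph V E L) : Finset (Set E) :=
  {T | G.IsSpanningTree T}

open scoped Classical in
/-- The edge sets of the spanning 2-forests of `G`, which index the momentum terms of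
`G.secondSymanzik z`. -/
noncomputable def twoForests (G : FeynmanGraph V E L) : Finset (Set E) :=
  {S | G.IsTwoForest S}

/-- The first Betti number of a connected graph `G`, which is the degree of `G.firstSymanzik`. The
subtraction does not truncate when `G` is connected. -/
noncomputable def loopNumber (_ : FeynmanGraph V E L) : ℕ :=
  Fintype.card E + 1 - Nat.card V

@[simp]
theorem mem_spanningTrees : T ∈ G.spanningTrees ↔ G.IsSpanningTree T := by
  simp [spanningTrees]

@[simp]
theorem mem_twoForests : S ∈ G.twoForests ↔ G.IsTwoForest S := by
  simp [twoForests]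

theorem complProd_le_sum_mul_insert {f : E} (hf : f ∉ S) (hx : ∀ e, 0 ≤ x e) :
    complProd S x ≤ (∑ e, x e) * complProd (insert f S) x := by
  rw [complProd_eq_mul_insert hf]
  exact mul_le_mul_of_nonneg_right
    (Finset.single_le_sum (fun e _ => hx e) (Finset.mem_univ f)) (complProd_nonneg _ hx)

/- The sums over `T : Finset E` in the definitions of the Symanzik polynomials elaborate to sums
over the image of `Finset E` in `Set E`. -/
theorem image_coe_univ [DecidableEq (Set E)] :
    Finset.univ.image ((↑) : Finset E → Set E) = Finset.univ :=
  Finset.image_univ_of_surjective fun S => ⟨S.toFinite.toFinset, S.toFinite.coe_toFinset⟩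

theorem firstSymanzik_eq_sum_monomial (G : FeynmanGraph V E L) :
    G.firstSymanzik = ∑ T ∈ G.spanningTrees, monomial (complExponent T) 1 := by
  simp only [firstSymanzik, Finset.bind_def, Finset.pure_def, Finset.sup_singleton_apply,
    image_coe_univ, monomial_complExponent, C_1, one_mul]
  refine Finset.sum_congr rfl fun T _ => Finset.prod_congr ?_ fun _ _ => rfl
  ext; simp

theorem hasOnlyPositiveCoeffs_firstSymanzik (G : FeynmanGraph V E L) :
    HasOnlyPositiveCoeffs G.firstSymanzik := by
  classical
  refine hasOnlyPositiveCoeffs_iff_coeff_nonneg.2 fun d => ?_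
  rw [firstSymanzik_eq_sum_monomial, coeff_sum]
  refine Finset.sum_nonneg fun T _ => ?_
  rw [coeff_monomial]
  split_ifs <;> norm_num

theorem mem_support_firstSymanzik {d : E →₀ ℕ} :
    d ∈ G.firstSymanzik.support ↔ ∃ T, G.IsSpanningTree T ∧ complExponent T = d := by
  classical
  simp only [mem_support_iff, firstSymanzik_eq_sum_monomial, coeff_sum, coeff_monomial]
  rw [Ne, Finset.sum_eq_zero_iff_of_nonneg fun T _ => by split_ifs <;> norm_num]
  simp

theorem eval_firstSymanzik (G : FeynmanGraph V E L) (x : E → ℝ) :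
    eval x G.firstSymanzik = ∑ T ∈ G.spanningTrees, complProd T x := by
  simp [firstSymanzik_eq_sum_monomial, eval_monomial_complExponent]

theorem eval_firstSymanzik_nonneg (G : FeynmanGraph V E L) (hx : ∀ e, 0 ≤ x e) :
    0 ≤ eval x G.firstSymanzik :=
  G.hasOnlyPositiveCoeffs_firstSymanzik.eval_nonneg hx

theorem IsSpanningTree.complProd_le (hT : G.IsSpanningTree T) (hx : ∀ e, 0 ≤ x e) :
    complProd T x ≤ eval x G.firstSymanzik := by
  rw [eval_firstSymanzik]
  exact Finset.single_le_sum (f := (complProd · x)) (fun S _ => complProd_nonneg S hx)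
    (mem_spanningTrees.2 hT)

theorem IsTwoForest.complProd_le (hS : G.IsTwoForest S) (hconn : G.IsConnected)
    (hx : ∀ e, 0 ≤ x e) : complProd S x ≤ (∑ e, x e) * eval x G.firstSymanzik := by
  obtain ⟨f, hf, hT⟩ := hS.exists_isSpanningTree_insert hconn
  exact (complProd_le_sum_mul_insert hf hx).trans
    (mul_le_mul_of_nonneg_left (hT.complProd_le hx) (Finset.sum_nonneg fun e _ => hx e))

theorem IsSpanningTree.exists_notMem_mul_complProd_le [Finite V] (hT : G.IsSpanningTree T)
    (hbridge : G.IsBridgeless) (e : E) :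
    ∃ T', G.IsSpanningTree T' ∧ e ∉ T' ∧ ∀ x : E → ℝ, (∀ f, 0 ≤ x f) →
      x e * complProd T x ≤ (∑ f, x f) * complProd T' x := by
  by_cases he : e ∈ T
  · obtain ⟨f, hf, hT', heT'⟩ := hT.exists_exchange he (hbridge e)
    refine ⟨_, hT', heT', fun x hx => ?_⟩
    calc x e * complProd T x = complProd (T \ {e}) x := by
          rw [complProd_eq_mul_insert (S := T \ {e}) (f := e) (by simp),
            Set.insert_sdiff_self_of_mem he]
      _ ≤ _ := complProd_le_sum_mul_insert hf hx
  · refine ⟨T, hT, he, fun x hx => mul_le_mul_of_nonneg_right ?_ (complProd_nonneg T hx)⟩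
    exact Finset.single_le_sum (fun f _ => hx f) (Finset.mem_univ e)

theorem IsSpanningTree.degree_complExponent [Finite V] (hT : G.IsSpanningTree T) :
    (complExponent T).degree = G.loopNumber := by
  have hcompl := Set.ncard_add_ncard_compl T
  have hcard := hT.ncard_add_one
  rw [FeynmanGraph.degree_complExponent, loopNumber, ← Nat.card_eq_fintype_card]
  omega

theorem IsTwoForest.degree_complExponent [Finite V] (hS : G.IsTwoForest S)
    (hconn : G.IsConnected) : (complExponent S).degree = G.loopNumber + 1 := by
  obtain ⟨f, hf, hT⟩ := hS.exists_isSpanningTree_insert hconn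
  have hcompl := Set.ncard_add_ncard_compl S
  have hcard := hT.ncard_add_one
  have hpos : 0 < Sᶜ.ncard := Set.ncard_pos (Set.toFinite _) |>.2 ⟨f, hf⟩
  rw [Set.ncard_insert_of_notMem hf] at hcard
  rw [FeynmanGraph.degree_complExponent, loopNumber, ← Nat.card_eq_fintype_card]
  omega

theorem isHomogeneous_firstSymanzik [Finite V] (G : FeynmanGraph V E L) :
    G.firstSymanzik.IsHomogeneous G.loopNumber := by
  rw [firstSymanzik_eq_sum_monomial]
  exact IsHomogeneous.sum _ _ _ fun T hT =>
    isHomogeneous_monomial _ (mem_spanningTrees.1 hT).degree_complExponent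

variable [Fintype L] {z : KinematicSpace E L}

theorem secondSymanzik_eq_sum_monomial_add (G : FeynmanGraph V E L) (z : KinematicSpace E L) :
    G.secondSymanzik z =
      ∑ S ∈ G.twoForests, monomial (complExponent S) (G.crossing S z.1.2) +
        (∑ e, C (z.1.1 e) * X e) * G.firstSymanzik := by
  simp only [secondSymanzik, Finset.bind_def, Finset.pure_def, Finset.sup_singleton_apply,
    image_coe_univ, monomial_complExponent]
  refine congrArg (· + _) (Finset.sum_congr rfl fun S _ => ?_)
  refine congrArg (_ * ·) (Finset.prod_congr ?_ fun _ _ => rfl)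
  ext; simp

theorem isHomogeneous_secondSymanzik [Finite V] (hconn : G.IsConnected)
    (z : KinematicSpace E L) : (G.secondSymanzik z).IsHomogeneous (G.loopNumber + 1) := by
  rw [secondSymanzik_eq_sum_monomial_add]
  refine (IsHomogeneous.sum _ _ _ fun S hS =>
    isHomogeneous_monomial _ ((mem_twoForests.1 hS).degree_complExponent hconn)).add ?_
  rw [add_comm]
  exact (IsHomogeneous.sum _ _ _ fun e _ => isHomogeneous_C_mul_X _ e).mul
    G.isHomogeneous_firstSymanzik

theorem eq_complExponent_or_eq_single_add_of_mem_support {b : E →₀ ℕ}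
    (hb : b ∈ (G.secondSymanzik z).support) :
    (∃ S, complExponent S = b) ∨
      ∃ e, ∃ d ∈ G.firstSymanzik.support, Finsupp.single e 1 + d = b := by
  classical
  rw [secondSymanzik_eq_sum_monomial_add] at hb
  rcases Finset.mem_union.1 (support_add hb) with hforest | hmass
  · obtain ⟨S, -, hS⟩ := Finset.mem_biUnion.1 (support_sum hforest)
    exact Or.inl ⟨S, (Finset.mem_singleton.1 (support_monomial_subset hS)).symm⟩
  · obtain ⟨a, ha, d, hd, rfl⟩ := Finset.mem_add.1 (support_mul _ _ hmass)
    obtain ⟨e, -, he⟩ := Finset.mem_biUnion.1 (support_sum ha)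
    rw [C_mul_X_eq_monomial] at he
    rw [Finset.mem_singleton.1 (support_monomial_subset he)]
    exact Or.inr ⟨e, d, hd, rfl⟩

theorem sub_single_mem_support_firstSymanzik {b : E →₀ ℕ}
    (hb : b ∈ (G.secondSymanzik z).support) {e : E} (he : 2 ≤ b e) :
    b - Finsupp.single e 1 ∈ G.firstSymanzik.support := by
  rcases eq_complExponent_or_eq_single_add_of_mem_support hb with ⟨S, rfl⟩ | ⟨f, d, hd, rfl⟩
  · exact absurd (complExponent_apply_le_one S e) (by omega)
  · obtain rfl : f = e := by
      by_contra hfe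
      obtain ⟨T, -, rfl⟩ := mem_support_firstSymanzik.1 hd
      rw [Finsupp.add_apply, Finsupp.single_eq_of_ne' hfe, zero_add] at he
      exact absurd (complExponent_apply_le_one T e) (by omega)
    rwa [add_tsub_cancel_left]

theorem eval_secondSymanzik (G : FeynmanGraph V E L) (z : KinematicSpace E L) (x : E → ℝ) :
    eval x (G.secondSymanzik z) = ∑ S ∈ G.twoForests, G.crossing S z.1.2 * complProd S x +
      (∑ e, z.1.1 e * x e) * eval x G.firstSymanzik := by
  simp [secondSymanzik_eq_sum_monomial_add, eval_monomial_complExponent]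

theorem constantCoeff_secondSymanzik [Finite V] (hconn : G.IsConnected) (z : KinematicSpace E L) :
    constantCoeff (G.secondSymanzik z) = 0 := by
  rw [constantCoeff_eq]
  exact (isHomogeneous_secondSymanzik hconn z).coeff_eq_zero (by simp)

theorem eval_secondSymanzik_of_eq_zero_on [Finite V] (hT : G.IsSpanningTree T)
    (z : KinematicSpace E L) (hx : ∀ e ∈ T, x e = 0) :
    eval x (G.secondSymanzik z) = (∑ e, z.1.1 e * x e) * complProd T x := by
  have hzero {S : Set E} (hTS : ¬ T ⊆ S) : complProd S x = 0 := by
    obtain ⟨e, heT, heS⟩ := Set.not_subset.1 hTS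
    exact complProd_eq_zero heS (hx e heT)
  have htree : eval x G.firstSymanzik = complProd T x := by
    rw [eval_firstSymanzik]
    refine Finset.sum_eq_single_of_mem T (mem_spanningTrees.2 hT) fun S hS hne => hzero ?_
    exact fun hTS => hne (hT.eq_of_subset (mem_spanningTrees.1 hS) hTS).symm
  have hforest : ∀ S ∈ G.twoForests, G.crossing S z.1.2 * complProd S x = 0 := fun S hS => by
    rw [hzero fun hTS => (mem_twoForests.1 hS).not_connected (hT.2.mono (sub_mono hTS)), mul_zero]
  rw [eval_secondSymanzik, Finset.sum_eq_zero hforest, zero_add, htree]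

theorem eval_secondSymanzik_sub (G : FeynmanGraph V E L) (z w : KinematicSpace E L) (x : E → ℝ) :
    eval x (G.secondSymanzik (z - w)) =
      eval x (G.secondSymanzik z) - eval x (G.secondSymanzik w) := by
  simp only [eval_secondSymanzik, Submodule.coe_sub, Prod.fst_sub, Prod.snd_sub, Pi.sub_apply,
    crossing_sub, sub_mul, Finset.sum_sub_distrib]
  ring

/-- The kinematic vector with all masses equal to `1` and all momenta equal to `0`. Its second
Symanzik polynomial is `(∑ e, X e) * G.firstSymanzik`. -/
def unitMasses (E L : Type*) [Fintype L] : KinematicSpace E L :=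
  ⟨(1, 0), Matrix.isSymm_zero, fun _ => Finset.sum_const_zero⟩

theorem eval_secondSymanzik_sub_smul_unitMasses (G : FeynmanGraph V E L) (z : KinematicSpace E L)
    (t : ℝ) (x : E → ℝ) :
    eval x (G.secondSymanzik (z - t • unitMasses E L)) =
      eval x (G.secondSymanzik z) - t * ((∑ e, x e) * eval x G.firstSymanzik) := by
  rw [eval_secondSymanzik_sub, eval_secondSymanzik _ (t • _)]
  simp [unitMasses, crossing_zero, ← Finset.mul_sum, mul_assoc]

end Symanzik

section CopositiveCone

open MvPolynomial Filter Topology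

variable {V E L : Type*} [Fintype E] [Fintype L] {G : FeynmanGraph V E L}
  {z : KinematicSpace E L} {x : E → ℝ} {T : Set E}

/-- `F_z` dominates a positive multiple of `(∑ e, X e) * U` on the nonnegative orthant. This
describes the interior of the copositive cone by inequalities and, unlike positivity of `F_z` on
the simplex, allows `F_z` to vanish on the faces where `U` does. -/
def IsStrictlyCopositive (G : FeynmanGraph V E L) (z : KinematicSpace E L) : Prop :=
  ∃ ε > 0, ∀ x : E → ℝ, (∀ e, 0 ≤ x e) →
    ε * ((∑ e, x e) * eval x G.firstSymanzik) ≤ eval x (G.secondSymanzik z)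

theorem isStrictlyCopositive_iff_exists_sub_smul_mem :
    G.IsStrictlyCopositive z ↔ ∃ ε > (0 : ℝ), z - ε • unitMasses E L ∈ G.copositiveCone := by
  simp [IsStrictlyCopositive, copositiveCone, eval_secondSymanzik_sub_smul_unitMasses]

theorem isStrictlyCopositive_of_mem_interior (hz : z ∈ interior G.copositiveCone) :
    G.IsStrictlyCopositive z := by
  have hline : Tendsto (fun t : ℝ => z - t • unitMasses E L) (𝓝[>] 0) (𝓝 z) := by
    have hcont : Continuous fun t : ℝ => z - t • unitMasses E L := by fun_prop
    simpa using (hcont.tendsto 0).mono_left nhdsWithin_le_nhds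
  obtain ⟨ε, hmem, hε⟩ :=
    ((hline.eventually (mem_interior_iff_mem_nhds.1 hz)).and self_mem_nhdsWithin).exists
  exact isStrictlyCopositive_iff_exists_sub_smul_mem.2 ⟨ε, hε, hmem⟩

theorem abs_eval_secondSymanzik_le (hconn : G.IsConnected) (z : KinematicSpace E L)
    (hx : ∀ e, 0 ≤ x e) :
    |eval x (G.secondSymanzik z)| ≤
      (∑ S ∈ G.twoForests, |G.crossing S z.1.2| + ∑ e, |z.1.1 e|) *
        ((∑ e, x e) * eval x G.firstSymanzik) := by
  have hU := G.eval_firstSymanzik_nonneg hx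
  rw [eval_secondSymanzik, add_mul]
  refine (abs_add_le _ _).trans (add_le_add ?_ ?_)
  · rw [Finset.sum_mul]
    refine (Finset.abs_sum_le_sum_abs _ _).trans (Finset.sum_le_sum fun S hS => ?_)
    rw [abs_mul, abs_of_nonneg (complProd_nonneg S hx)]
    gcongr
    exact (mem_twoForests.1 hS).complProd_le hconn hx
  · rw [abs_mul, abs_of_nonneg hU, ← mul_assoc]
    gcongr
    rw [Finset.sum_mul]
    refine (Finset.abs_sum_le_sum_abs _ _).trans (Finset.sum_le_sum fun e _ => ?_)
    rw [abs_mul, abs_of_nonneg (hx e)]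
    gcongr
    exact Finset.single_le_sum (fun e _ => hx e) (Finset.mem_univ e)

theorem IsStrictlyCopositive.mem_interior (hz : G.IsStrictlyCopositive z)
    (hconn : G.IsConnected) : z ∈ interior G.copositiveCone := by
  obtain ⟨ε, hε, hle⟩ := hz
  let size (w : KinematicSpace E L) : ℝ :=
    ∑ S ∈ G.twoForests, |G.crossing S w.1.2| + ∑ e, |w.1.1 e|
  have hsize : Continuous fun w => size (z - w) := by
    have := G.continuous_crossing
    fun_prop
  have hsize0 : size (z - z) < ε := by simpa [size, crossing_zero] using hε
  rw [mem_interior_iff_mem_nhds]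
  filter_upwards [hsize.continuousAt.eventually_lt_const hsize0] with w hw x hx
  have hsum : 0 ≤ ∑ e, x e := Finset.sum_nonneg fun e _ => hx e
  have hU := G.eval_firstSymanzik_nonneg hx
  have hdiff : eval x (G.secondSymanzik z) - eval x (G.secondSymanzik w) ≤
      ε * ((∑ e, x e) * eval x G.firstSymanzik) := by
    rw [← eval_secondSymanzik_sub]
    refine ((le_abs_self _).trans (abs_eval_secondSymanzik_le hconn _ hx)).trans ?_
    gcongr
  linarith [hle x hx]

theorem mem_interior_copositiveCone_iff (hconn : G.IsConnected) :
    z ∈ interior G.copositiveCone ↔ G.IsStrictlyCopositive z :=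
  ⟨isStrictlyCopositive_of_mem_interior, fun hz => hz.mem_interior hconn⟩

theorem mass_nonneg_of_mem_copositiveCone [Finite V] (hbridge : G.IsBridgeless)
    (hz : z ∈ G.copositiveCone) (e : E) : 0 ≤ z.1.1 e := by
  classical
  obtain ⟨T, hT, heT⟩ := hbridge.exists_isSpanningTree_notMem e
  let ray (s : ℝ) : E → ℝ := s • Tᶜ.indicator 1 + Pi.single e 1
  have hmasses {s : ℝ} (hs : 0 < s) : 0 ≤ ∑ f, z.1.1 f * ray s f := by
    have hzero : ∀ f ∈ T, ray s f = 0 := fun f hf => by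
      simp [ray, hf, ne_of_mem_of_not_mem hf heT]
    have hpos : ∀ f ∉ T, 0 < ray s f := fun f hf => by
      have hsingle : (0 : E → ℝ) ≤ Pi.single e 1 := Pi.single_nonneg.2 zero_le_one
      simpa [ray, hf] using add_pos_of_pos_of_nonneg hs (hsingle f)
    have hF := hz (ray s) fun f => by
      by_cases hf : f ∈ T
      exacts [(hzero f hf).ge, (hpos f hf).le]
    rw [eval_secondSymanzik_of_eq_zero_on hT z hzero] at hF
    exact nonneg_of_mul_nonneg_left hF (complProd_pos hpos)
  have hlim : Tendsto (fun s => ∑ f, z.1.1 f * ray s f) (𝓝[>] 0) (𝓝 (z.1.1 e)) := by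
    have hcont : Continuous fun s => ∑ f, z.1.1 f * ray s f := by fun_prop
    simpa [ray, Pi.single_apply] using (hcont.tendsto 0).mono_left nhdsWithin_le_nhds
  exact ge_of_tendsto hlim (eventually_nhdsWithin_of_forall fun s hs => hmasses hs)

theorem IsStrictlyCopositive.mass_pos [Finite V] (hz : G.IsStrictlyCopositive z)
    (hbridge : G.IsBridgeless) (e : E) : 0 < z.1.1 e := by
  obtain ⟨ε, hε, hmem⟩ := isStrictlyCopositive_iff_exists_sub_smul_mem.1 hz
  have hm : ε ≤ z.1.1 e := by
    simpa [unitMasses] using mass_nonneg_of_mem_copositiveCone hbridge hmem e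
  exact hε.trans_le hm

theorem IsStrictlyCopositive.exists_hasOnlyPositiveCoeffs [Finite V]
    (hz : G.IsStrictlyCopositive z) (hconn : G.IsConnected) :
    ∃ N : ℕ, HasOnlyPositiveCoeffs ((∑ e, X e) ^ N * G.secondSymanzik z) := by
  obtain ⟨ε, hε, hle⟩ := hz
  exact exists_hasOnlyPositiveCoeffs_sum_X_pow_mul (isHomogeneous_secondSymanzik hconn z)
    G.hasOnlyPositiveCoeffs_firstSymanzik
    (fun b hb e he => sub_single_mem_support_firstSymanzik hb he) hε hle

/- Monotonicity on the orthant lets us pass to the face where the coordinates in `T` vanish, on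
which `F_z` factors. -/
theorem IsSpanningTree.mass_mul_pow_mul_complProd_le_of_notMem [Finite V] (hT : G.IsSpanningTree T)
    {N : ℕ} (hm : ∀ e, 0 ≤ z.1.1 e)
    (hpos : HasOnlyPositiveCoeffs ((∑ e, X e) ^ N * G.secondSymanzik z)) (hx : ∀ e, 0 ≤ x e)
    {e : E} (he : e ∉ T) :
    z.1.1 e * x e ^ (N + 1) * complProd T x ≤
      (∑ f, x f) ^ N * eval x (G.secondSymanzik z) := by
  let y := Tᶜ.indicator x
  have hy : ∀ f, 0 ≤ y f := Set.indicator_nonneg fun f _ => hx f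
  have hye : y e = x e := Set.indicator_of_mem he x
  have hsum : x e ≤ ∑ f, y f :=
    hye ▸ Finset.single_le_sum (fun f _ => hy f) (Finset.mem_univ e)
  have hmass : z.1.1 e * x e ≤ ∑ f, z.1.1 f * y f :=
    hye ▸ Finset.single_le_sum (f := fun f => z.1.1 f * y f)
      (fun f _ => mul_nonneg (hm f) (hy f)) (Finset.mem_univ e)
  have hface : eval y (G.secondSymanzik z) = (∑ f, z.1.1 f * y f) * complProd T x := by
    rw [eval_secondSymanzik_of_eq_zero_on hT z fun f hf => Set.indicator_of_notMem (by simpa) _,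
      complProd_congr fun f hf => Set.indicator_of_mem hf x]
  have hmono := hpos.eval_mono hy (y := x) (Set.indicator_le_self' fun f _ => hx f)
  simp only [map_mul, map_pow, map_sum, eval_X] at hmono
  have hprod := complProd_nonneg T hx
  calc z.1.1 e * x e ^ (N + 1) * complProd T x
      = x e ^ N * ((z.1.1 e * x e) * complProd T x) := by ring
    _ ≤ (∑ f, y f) ^ N * ((∑ f, z.1.1 f * y f) * complProd T x) := by
        have := hx e
        have := mul_nonneg (hm e) (hx e)
        have := Finset.sum_nonneg fun f (_ : f ∈ Finset.univ) => hy f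
        gcongr
    _ ≤ (∑ f, x f) ^ N * eval x (G.secondSymanzik z) := by rwa [← hface]

theorem IsSpanningTree.mass_mul_pow_mul_complProd_le [Finite V] (hT : G.IsSpanningTree T)
    (hbridge : G.IsBridgeless) {N : ℕ} (hm : ∀ e, 0 ≤ z.1.1 e)
    (hpos : HasOnlyPositiveCoeffs ((∑ e, X e) ^ N * G.secondSymanzik z)) (hx : ∀ e, 0 ≤ x e)
    (e : E) :
    z.1.1 e * x e ^ (N + 2) * complProd T x ≤
      (∑ f, x f) ^ (N + 1) * eval x (G.secondSymanzik z) := by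
  obtain ⟨T', hT', he, hexchange⟩ := hT.exists_notMem_mul_complProd_le hbridge e
  have hsum : 0 ≤ ∑ f, x f := Finset.sum_nonneg fun f _ => hx f
  calc z.1.1 e * x e ^ (N + 2) * complProd T x
      = z.1.1 e * x e ^ (N + 1) * (x e * complProd T x) := by ring
    _ ≤ z.1.1 e * x e ^ (N + 1) * ((∑ f, x f) * complProd T' x) :=
        mul_le_mul_of_nonneg_left (hexchange x hx) (mul_nonneg (hm e) (pow_nonneg (hx e) _))
    _ = (∑ f, x f) * (z.1.1 e * x e ^ (N + 1) * complProd T' x) := by ring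
    _ ≤ (∑ f, x f) * ((∑ f, x f) ^ N * eval x (G.secondSymanzik z)) :=
        mul_le_mul_of_nonneg_left (hT'.mass_mul_pow_mul_complProd_le_of_notMem hm hpos hx he) hsum
    _ = _ := by ring

theorem IsBridgeless.mass_mul_pow_mul_eval_firstSymanzik_le [Finite V] (hbridge : G.IsBridgeless)
    {N : ℕ} (hm : ∀ e, 0 ≤ z.1.1 e)
    (hpos : HasOnlyPositiveCoeffs ((∑ e, X e) ^ N * G.secondSymanzik z)) (hx : ∀ e, 0 ≤ x e)
    (e : E) :
    z.1.1 e * x e ^ (N + 2) * eval x G.firstSymanzik ≤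
      G.spanningTrees.card * ((∑ f, x f) ^ (N + 1) * eval x (G.secondSymanzik z)) := by
  rw [eval_firstSymanzik, Finset.mul_sum, ← nsmul_eq_mul]
  exact Finset.sum_le_card_nsmul _ _ _ fun T hT =>
    (mem_spanningTrees.1 hT).mass_mul_pow_mul_complProd_le hbridge hm hpos hx e

theorem IsBridgeless.exists_sum_pow_mul_eval_firstSymanzik_le [Finite V]
    (hbridge : G.IsBridgeless) {N : ℕ} (hm : ∀ e, 0 < z.1.1 e)
    (hpos : HasOnlyPositiveCoeffs ((∑ e, X e) ^ N * G.secondSymanzik z)) :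
    ∃ K : ℝ, ∀ x : E → ℝ, (∀ e, 0 ≤ x e) →
      (∑ e, x e) ^ (N + 2) * eval x G.firstSymanzik ≤
        K * ((∑ e, x e) ^ (N + 1) * eval x (G.secondSymanzik z)) := by
  let n : ℝ := Fintype.card E
  let τ : ℝ := G.spanningTrees.card
  refine ⟨n ^ (N + 1) * ∑ e, τ / z.1.1 e, fun x hx => ?_⟩
  have hU := G.eval_firstSymanzik_nonneg hx
  set B := (∑ e, x e) ^ (N + 1) * eval x (G.secondSymanzik z)
  have hedge (e : E) : x e ^ (N + 2) * eval x G.firstSymanzik ≤ τ / z.1.1 e * B := by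
    rw [div_mul_eq_mul_div, le_div_iff₀' (hm e), ← mul_assoc]
    exact hbridge.mass_mul_pow_mul_eval_firstSymanzik_le (fun e => (hm e).le) hpos hx e
  have hpower : (∑ e, x e) ^ (N + 2) ≤ n ^ (N + 1) * ∑ e, x e ^ (N + 2) := by
    rcases isEmpty_or_nonempty E with _ | _
    · simp
    · have hn : 0 < n := Nat.cast_pos.2 Fintype.card_pos
      exact (div_le_iff₀' (pow_pos hn _)).1
        (pow_sum_div_card_le_sum_pow (fun e _ => hx e) (N + 1))
  calc (∑ e, x e) ^ (N + 2) * eval x G.firstSymanzik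
      ≤ n ^ (N + 1) * (∑ e, x e ^ (N + 2)) * eval x G.firstSymanzik := by gcongr
    _ = n ^ (N + 1) * ∑ e, x e ^ (N + 2) * eval x G.firstSymanzik := by
        rw [mul_assoc, Finset.sum_mul]
    _ ≤ n ^ (N + 1) * ∑ e, τ / z.1.1 e * B := by
        gcongr n ^ (N + 1) * ∑ e, ?_ with e
        exact hedge e
    _ = n ^ (N + 1) * (∑ e, τ / z.1.1 e) * B := by rw [← Finset.sum_mul, mul_assoc]

theorem isStrictlyCopositive_of_hasOnlyPositiveCoeffs [Finite V] (hconn : G.IsConnected)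
    (hbridge : G.IsBridgeless) (hm : ∀ e, 0 < z.1.1 e) {N : ℕ}
    (hpos : HasOnlyPositiveCoeffs ((∑ e, X e) ^ N * G.secondSymanzik z)) :
    G.IsStrictlyCopositive z := by
  obtain ⟨K, hK⟩ := hbridge.exists_sum_pow_mul_eval_firstSymanzik_le hm hpos
  refine ⟨(|K| + 1)⁻¹, by positivity, fun x hx => ?_⟩
  have hsum : 0 ≤ ∑ e, x e := Finset.sum_nonneg fun e _ => hx e
  rcases hsum.eq_or_lt with hzero | hsum
  · obtain rfl : x = 0 := (Fintype.sum_eq_zero_iff_of_nonneg hx).1 hzero.symm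
    simp [constantCoeff_secondSymanzik hconn]
  · have hF : 0 ≤ eval x (G.secondSymanzik z) := by
      refine nonneg_of_mul_nonneg_right (a := (∑ e, x e) ^ N) ?_ (pow_pos hsum N)
      simpa using hpos.eval_nonneg hx
    have hKF : (∑ e, x e) * eval x G.firstSymanzik ≤ K * eval x (G.secondSymanzik z) := by
      refine le_of_mul_le_mul_left ?_ (pow_pos hsum (N + 1))
      calc (∑ e, x e) ^ (N + 1) * ((∑ e, x e) * eval x G.firstSymanzik)
          = (∑ e, x e) ^ (N + 2) * eval x G.firstSymanzik := by ring
        _ ≤ K * ((∑ e, x e) ^ (N + 1) * eval x (G.secondSymanzik z)) := hK x hx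
        _ = (∑ e, x e) ^ (N + 1) * (K * eval x (G.secondSymanzik z)) := by ring
    rw [inv_mul_le_iff₀ (by positivity)]
    refine hKF.trans (mul_le_mul_of_nonneg_right ?_ hF)
    linarith [le_abs_self K]

end CopositiveCone

end FeynmanGraph

theorem mainTheorem1 {V E L : Type*} [Fintype V] [Fintype E] [Fintype L]
    (G : FeynmanGraph V E L) (hconn : G.IsConnected) (hbridge : G.IsBridgeless)
    (z : FeynmanGraph.KinematicSpace E L) :
    z ∈ interior G.copositiveCone ↔
      (∀ e : E, 0 < z.1.1 e) ∧
        ∃ N : ℕ, HasOnlyPositiveCoeffs ((∑ e : E, MvPolynomial.X e) ^ N * G.secondSymanzik z) := by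
  rw [FeynmanGraph.mem_interior_copositiveCone_iff hconn]
  constructor
  · intro hz
    exact ⟨hz.mass_pos hbridge, hz.exists_hasOnlyPositiveCoeffs hconn⟩
  · rintro ⟨hm, N, hpos⟩
    exact FeynmanGraph.isStrictlyCopositive_of_hasOnlyPositiveCoeffs hconn hbridge hm hpos
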